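/- Let $X=(X(t))_{t\in\mathbb R}$ be a real, centered, stationary Gaussian process on a probability space $(\Omega,\mathcal A,\mathbf P)$ with reduced covariance function $C_X(t)=\mathrm{Cov}(X(t),X(0))$, normalised by $C_X(0)=1$. Assume that the paths of $X$ are almost surely of class $\mathcal C^1$ and that there is a sequence $t_n\to+\infty$ with $|C_X(t_n)|\to 1$. Let $Z_X=\{t\in\mathbb R: X(t)=0\}$. The space $\mathscr N(\mathbb R)$ of locally finite subsets of $\mathbb R$ carries the $\sigma$-algebra generated by the maps $Z\mapsto \#(Z\cap A)$, $A\subset\mathbb R$ Borel. A point process is a random element of $\mathscr N(\mathbb R)$, and for $A\subset\mathbb R$, $\sigma(Z\cap A)$ is the $\sigma$-algebra on $\Omega$ generated by $\omega\mapsto Z(\omega)\cap A$. Then, up to modification on a $\mathbf P$-null set, $Z_X$ is a point process (in particular, it is almost surely locally finite), and it is completely predictable: $$\sigma(Z_X)=\bigcap_{t\in\mathbb R}\sigma\bigl(Z_X\cap(-\infty,t)\bigr)\quad\text{modulo }\mathbf P\text{-null sets},$$ i.e. the two $\sigma$-algebras coincide after all $\mathbf P$-null sets are adjoined to both sides. In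 particular $Z_X$ is maximally rigid: for every bounded measurable $\varphi:\mathscr N(\mathbb R)\to\mathbb R$ and every $T>0$, $\varphi(Z_X\cap[-T,T])$ is measurable with respect to $\sigma(Z_X\cap[-T,T]^c)$ modulo $\mathbf P$-null sets. -/

import Mathlib

open MeasureTheory ProbabilityTheory Filter Topology

/-- A set of reals is locally finite if its trace on every bounded interval is finite. -/
def IsLocallyFiniteSet (s : Set ℝ) : Prop := ∀ a b : ℝ, (s ∩ Set.Icc a b).Finite

/-- The space of locally finite subsets of `ℝ`. -/
def Config : Type := {s : Set ℝ // IsLocallyFiniteSet s}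

/-- The σ-algebra on locally finite sets generated by the counting maps `Z ↦ #(Z ∩ A)`,
`A` a Borel subset of `ℝ` (with values in `ℕ∞`). -/
noncomputable instance Config.instMeasurableSpace : MeasurableSpace Config :=
  ⨆ (A : Set ℝ) (_ : MeasurableSet A),
    MeasurableSpace.comap (fun Z : Config => (Z.1 ∩ A).encard) inferInstance

/-- The empty configuration. -/
def Config.empty : Config := ⟨∅, fun a b => by simp⟩

/-- The restriction `Z ∩ A` of a configuration to a set `A`. -/
def Config.restrict (Z : Config) (A : Set ℝ) : Config :=
  ⟨Z.1 ∩ A, fun a b => (Z.2 a b).subset fun _ hx => ⟨hx.1.1, hx.2⟩⟩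

section

variable {Ω : Type*} [mΩ : MeasurableSpace Ω]

/-- The zeros of the path `t ↦ X t ω`. -/
def zeroSet (X : ℝ → Ω → ℝ) (ω : Ω) : Set ℝ := {t : ℝ | X t ω = 0}

open Classical in
/-- The zero set of `X` as a random configuration. (The value `∅` is used for the paths whose zero
set is not locally finite; that these form a null set is to be established separately.) -/
noncomputable def zeroProcess (X : ℝ → Ω → ℝ) (ω : Ω) : Config :=
  if h : IsLocallyFiniteSet (zeroSet X ω) then ⟨zeroSet X ω, h⟩ else Config.empty

/-- Stationarity: all finite dimensional distributions are invariant under shifts. -/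
def IsStationaryProcess (X : ℝ → Ω → ℝ) (P : Measure Ω) : Prop :=
  ∀ (h : ℝ) (I : Finset ℝ),
    IdentDistrib (fun ω => I.restrict (fun t => X (t + h) ω))
      (fun ω => I.restrict (fun t => X t ω)) P P

/-- The reduced covariance function `C_X(t) = Cov(X(t), X(0))` of a stationary process. -/
noncomputable def reducedCov (X : ℝ → Ω → ℝ) (P : Measure Ω) (t : ℝ) : ℝ :=
  cov[X t, X 0; P]

/-- The σ-algebra on `Ω` generated by the restriction `Z ∩ A`. -/
noncomputable abbrev sigmaRestrict (Z : Ω → Config) (A : Set ℝ) : MeasurableSpace Ω :=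
  MeasurableSpace.comap (fun ω => (Z ω).restrict A) inferInstance

/-- Complete predictability: `σ(Z) = ⋂ₜ σ(Z ∩ (-∞, t))`, as σ-algebras modulo `P`-null sets,
that is, after adjoining all `P`-null sets to both sides. -/
def CompletelyPredictable (Z : Ω → Config) (P : Measure Ω) : Prop :=
  eventuallyMeasurableSpace (MeasurableSpace.comap Z inferInstance) (ae P) =
    eventuallyMeasurableSpace (⨅ t : ℝ, sigmaRestrict Z (Set.Iio t)) (ae P)

/-- `φ`-rigidity: for all `T > 0`, the random variable `φ(Z ∩ [-T, T])` is measurable with respect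
to `σ(Z ∩ [-T, T]ᶜ)` modulo `P`-null sets. -/
def IsRigidFor (φ : Config → ℝ) (Z : Ω → Config) (P : Measure Ω) : Prop :=
  ∀ T : ℝ, 0 < T →
    EventuallyMeasurable (sigmaRestrict Z (Set.Icc (-T) T)ᶜ) (ae P)
      (fun ω => φ ((Z ω).restrict (Set.Icc (-T) T)))

/-- Maximal rigidity: `φ`-rigidity for every bounded measurable `φ`. -/
def MaximallyRigid (Z : Ω → Config) (P : Measure Ω) : Prop :=
  ∀ φ : Config → ℝ, Measurable φ → (∃ M : ℝ, ∀ z, |φ z| ≤ M) → IsRigidFor φ Z P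

end

/-- All zeros of `f` are simple. -/
def HasSimpleZeros (f : ℝ → ℝ) : Prop := ∀ z, f z = 0 → deriv f z ≠ 0

theorem exists_zero_of_mul_neg {f : ℝ → ℝ} (hf : Continuous f) {a b : ℝ} (hab : a < b)
    (h : f a * f b < 0) : ∃ z ∈ Set.Ioo a b, f z = 0 := by
  rcases mul_neg_iff.1 h with ⟨ha, hb⟩ | ⟨ha, hb⟩
  · obtain ⟨z, hz, hz0⟩ := intermediate_value_Ioo' hab.le hf.continuousOn ⟨hb, ha⟩
    exact ⟨z, hz, hz0⟩
  · obtain ⟨z, hz, hz0⟩ := intermediate_value_Ioo hab.le hf.continuousOn ⟨ha, hb⟩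
    exact ⟨z, hz, hz0⟩

theorem exists_bracket_of_deriv_ne_zero {f : ℝ → ℝ} {z a b : ℝ} (hz : f z = 0)
    (hd : deriv f z ≠ 0) (haz : a < z) (hzb : z < b) :
    ∃ c d, a < c ∧ c < z ∧ z < d ∧ d < b ∧ f c * f d < 0 ∧
      ∀ x ∈ Set.Icc c d, f x = 0 → x = z := by
  -- Since `deriv` is 0 by default at points of non-differentiability, a nonzero value implies
  -- differentiability.
  have hda : HasDerivAt f (deriv f z) z := (differentiableAt_of_deriv_ne_zero hd).hasDerivAt
  have h1 := (hasDerivAt_iff_tendsto_slope.1 hda).mul_const (deriv f z)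
  have h2 : ∀ᶠ x in 𝓝[≠] z, 0 < slope f z x * deriv f z :=
    h1.eventually (lt_mem_nhds (mul_self_pos.2 hd))
  rw [eventually_nhdsWithin_iff] at h2
  obtain ⟨ε, hε, h3⟩ := Metric.eventually_nhds_iff.1 h2
  have key : ∀ x, |x - z| < ε → x ≠ z → 0 < (x - z) * f x * deriv f z := by
    intro x hx hxz
    have h4 := h3 (by rwa [Real.dist_eq]) hxz
    rw [slope_def_field, hz, sub_zero] at h4
    have hxz' : x - z ≠ 0 := sub_ne_zero.2 hxz
    have : (x - z) * f x * deriv f z = (x - z) ^ 2 * (f x / (x - z) * deriv f z) := by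
      field_simp
    rw [this]
    positivity
  obtain ⟨δ, hδ, hδ1, hδ2, hδ3⟩ : ∃ δ, 0 < δ ∧ δ < ε ∧ δ < z - a ∧ δ < b - z := by
    obtain ⟨δ, h0, h1⟩ := exists_between
      (lt_min hε (lt_min (sub_pos.2 haz) (sub_pos.2 hzb)))
    simp only [lt_min_iff] at h1
    exact ⟨δ, h0, h1⟩
  refine ⟨z - δ, z + δ, by linarith, by linarith, by linarith, by linarith, ?_, ?_⟩
  · have hc := key (z - δ) (by rw [abs_lt]; constructor <;> linarith) (by linarith)
    have hd' := key (z + δ) (by rw [abs_lt]; constructor <;> linarith) (by linarith)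
    have h5 := mul_pos hc hd'
    have h6 : (z - δ - z) * f (z - δ) * deriv f z * ((z + δ - z) * f (z + δ) * deriv f z)
        = -(f (z - δ) * f (z + δ)) * (δ * deriv f z) ^ 2 := by ring
    rw [h6] at h5
    have := pos_of_mul_pos_left h5 (sq_nonneg _)
    linarith
  · rintro x ⟨hx1, hx2⟩ hx0
    by_contra hne
    have := key x (by rw [abs_lt]; constructor <;> linarith) hne
    simp [hx0] at this

theorem HasSimpleZeros.isLocallyFiniteSet {f : ℝ → ℝ} (hf : Continuous f)
    (hs : HasSimpleZeros f) : IsLocallyFiniteSet {t | f t = 0} := by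
  intro a b
  by_contra hinf
  obtain ⟨z, -, hacc⟩ := Set.Infinite.exists_accPt_of_subset_isCompact hinf isCompact_Icc
    Set.inter_subset_right
  have hz : f z = 0 := by
    have hcl : IsClosed {t | f t = 0} := isClosed_eq hf continuous_const
    have : AccPt z (𝓟 {t | f t = 0}) := hacc.mono (by simp)
    exact hcl.closure_subset this.clusterPt.mem_closure
  have h := (differentiableAt_of_deriv_ne_zero (hs z hz)).hasDerivAt.eventually_ne (c := 0)
    (hs z hz)
  obtain ⟨x, hx1, hx2⟩ := ((accPt_iff_frequently_nhdsNE.1 hacc).and_eventually h).exists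
  exact hx2 hx1.1

/-- Remove a bracket `[c, d]` around one zero: it contributes one sign change, and both remaining
intervals contain fewer zeros. -/
theorem HasSimpleZeros.sign_mul_pos {f : ℝ → ℝ} (hf : Continuous f) (hs : HasSimpleZeros f)
    (n : ℕ) : ∀ a b : ℝ, a < b → f a ≠ 0 → f b ≠ 0 → ({t | f t = 0} ∩ Set.Ioo a b).encard = n →
      0 < (-1) ^ n * (f a * f b) := by
  induction n using Nat.strong_induction_on with
  | _ n ih =>
  intro a b hab ha hb hn
  rcases Set.eq_empty_or_nonempty ({t | f t = 0} ∩ Set.Ioo a b) with he | ⟨z, hz, haz, hzb⟩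
  · have hn0 : n = 0 := by simpa [he] using hn.symm
    subst hn0
    rw [pow_zero, one_mul]
    by_contra hneg
    obtain ⟨z, hz, hz0⟩ := exists_zero_of_mul_neg hf hab
      (lt_of_le_of_ne (not_lt.1 hneg) (mul_ne_zero ha hb))
    exact he.subset ⟨hz0, hz⟩
  · obtain ⟨c, d, hac, hcz, hzd, hdb, hcd, huniq⟩ :=
      exists_bracket_of_deriv_ne_zero hz (hs z hz) haz hzb
    have hsplit : {t | f t = 0} ∩ Set.Ioo a b =
        insert z (({t | f t = 0} ∩ Set.Ioo a c) ∪ ({t | f t = 0} ∩ Set.Ioo d b)) := by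
      ext x
      simp only [Set.mem_inter_iff, Set.mem_ofPred_eq, Set.mem_Ioo, Set.mem_insert_iff,
        Set.mem_union]
      constructor
      · rintro ⟨hx0, hxa, hxb⟩
        rcases lt_or_ge x c with h | h
        · exact Or.inr (Or.inl ⟨hx0, hxa, h⟩)
        rcases lt_or_ge d x with h' | h'
        · exact Or.inr (Or.inr ⟨hx0, h', hxb⟩)
        · exact Or.inl (huniq x ⟨h, h'⟩ hx0)
      · rintro (rfl | ⟨hx0, hxa, hxb⟩ | ⟨hx0, hxa, hxb⟩)
        · exact ⟨hz, haz, hzb⟩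
        · exact ⟨hx0, hxa, by linarith⟩
        · exact ⟨hx0, by linarith, hxb⟩
    have hdisj : Disjoint ({t | f t = 0} ∩ Set.Ioo a c) ({t | f t = 0} ∩ Set.Ioo d b) := by
      rw [Set.disjoint_left]
      rintro x ⟨-, -, h1⟩ ⟨-, h2, -⟩
      linarith
    have hznot : z ∉ ({t | f t = 0} ∩ Set.Ioo a c) ∪ ({t | f t = 0} ∩ Set.Ioo d b) := by
      rintro (⟨-, -, h1⟩ | ⟨-, h1, -⟩) <;> linarith
    rw [hsplit, Set.encard_insert_of_notMem hznot, Set.encard_union_eq hdisj] at hn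
    obtain ⟨n1, hn1⟩ := ENat.ne_top_iff_exists.1
      (show ({t | f t = 0} ∩ Set.Ioo a c).encard ≠ ⊤ by intro h; simp [h] at hn)
    obtain ⟨n2, hn2⟩ := ENat.ne_top_iff_exists.1
      (show ({t | f t = 0} ∩ Set.Ioo d b).encard ≠ ⊤ by intro h; simp [h] at hn)
    rw [← hn1, ← hn2] at hn
    have hn' : n1 + n2 + 1 = n := by exact_mod_cast hn
    have hc : f c ≠ 0 := fun h => by simp [h] at hcd
    have hd : f d ≠ 0 := fun h => by simp [h] at hcd
    have h1 := ih n1 (by omega) a c hac ha hc hn1.symm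
    have h2 := ih n2 (by omega) d b hdb hd hb hn2.symm
    have h3 := mul_pos (mul_pos h1 h2) (neg_pos.2 hcd)
    have h4 : (-1) ^ n1 * (f a * f c) * ((-1) ^ n2 * (f d * f b)) * -(f c * f d)
        = (-1) ^ n * (f a * f b) * (f c * f d) ^ 2 := by
      rw [← hn', pow_add, pow_add]; ring
    rw [h4] at h3
    exact pos_of_mul_pos_left h3 (sq_nonneg _)

theorem IsLocallyFiniteSet.finite_Ioo {s : Set ℝ} (hs : IsLocallyFiniteSet s) (a b : ℝ) :
    (s ∩ Set.Ioo a b).Finite :=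
  (hs a b).subset (Set.inter_subset_inter_right _ Set.Ioo_subset_Icc_self)

theorem HasSimpleZeros.mul_neg_iff_odd {f : ℝ → ℝ} (hf : Continuous f) (hs : HasSimpleZeros f)
    {a b : ℝ} (hab : a < b) (ha : f a ≠ 0) (hb : f b ≠ 0) :
    f a * f b < 0 ↔ ∃ n : ℕ, Odd n ∧ ({t | f t = 0} ∩ Set.Ioo a b).encard = n := by
  obtain ⟨n, hn⟩ := ENat.ne_top_iff_exists.1
    ((hs.isLocallyFiniteSet hf).finite_Ioo a b).encard_lt_top.ne
  have h := hs.sign_mul_pos hf n a b hab ha hb hn.symm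
  constructor
  · intro hneg
    refine ⟨n, ?_, hn.symm⟩
    by_contra hev
    rw [(Nat.not_odd_iff_even.1 hev).neg_one_pow] at h
    linarith
  · rintro ⟨m, hm, hm'⟩
    have hmn : m = n := by rw [hm'] at hn; exact_mod_cast hn.symm
    subst hmn
    rw [hm.neg_one_pow] at h
    linarith

theorem HasSimpleZeros.nonempty_inter_Ioo_iff {f : ℝ → ℝ} (hf : Continuous f)
    (hs : HasSimpleZeros f) (a b : ℝ) :
    ({t | f t = 0} ∩ Set.Ioo a b).Nonempty ↔
      ∃ q r : ℚ, a < q ∧ q < r ∧ (r : ℝ) < b ∧ f q * f r < 0 := by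
  constructor
  · rintro ⟨z, hz, haz, hzb⟩
    obtain ⟨c, d, hac, hcz, hzd, hdb, hcd, -⟩ :=
      exists_bracket_of_deriv_ne_zero hz (hs z hz) haz hzb
    have hU : IsOpen {p : ℝ × ℝ | f p.1 * f p.2 < 0 ∧ a < p.1 ∧ p.1 < p.2 ∧ p.2 < b} := by
      refine (isOpen_lt ((hf.comp continuous_fst).mul (hf.comp continuous_snd)) continuous_const).inter
        ((isOpen_lt continuous_const continuous_fst).inter
        ((isOpen_lt continuous_fst continuous_snd).inter
          (isOpen_lt continuous_snd continuous_const)))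
    obtain ⟨⟨q, r⟩, h1, h2, h3, h4⟩ := ((Rat.denseRange_cast (𝕜 := ℝ)).prodMap
      Rat.denseRange_cast).exists_mem_open
      hU ⟨(c, d), hcd, hac, by simp only; linarith, hdb⟩
    exact ⟨q, r, h2, Rat.cast_lt.1 h3, h4, h1⟩
  · rintro ⟨q, r, hq, hqr, hr, h⟩
    obtain ⟨z, hz, hz0⟩ := exists_zero_of_mul_neg hf (by exact_mod_cast hqr) h
    exact ⟨z, hz0, hq.trans hz.1, hz.2.trans hr⟩

/-! ### Measurability of random configurations -/

theorem succ_le_encard_inter_Ioo_iff {s : Set ℝ} (hs : IsLocallyFiniteSet s) (a b : ℝ) (k : ℕ) :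
    ((k + 1 : ℕ) : ℕ∞) ≤ (s ∩ Set.Ioo a b).encard ↔
      ∃ c : ℚ, a < c ∧ (c : ℝ) < b ∧ (k : ℕ∞) ≤ (s ∩ Set.Ioo a c).encard ∧
        (s ∩ Set.Ioo (c : ℝ) b).Nonempty := by
  constructor
  · intro h
    have hne : (s ∩ Set.Ioo a b).Nonempty := by
      rw [Set.nonempty_iff_ne_empty]
      intro he
      simp [he] at h
    -- The rational `c` separates the last point `z` from its predecessor `w`, where `w = a` if
    -- there is none.
    obtain ⟨z, ⟨hz, haz, hzb⟩, hmax⟩ := Set.exists_max_image _ id (hs.finite_Ioo a b) hne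
    obtain ⟨w, hw, hwmax⟩ := Set.exists_max_image (insert a (s ∩ Set.Ioo a z)) id
      ((hs.finite_Ioo a z).insert a) (Set.insert_nonempty _ _)
    have hwz : w < z := by
      rcases hw with rfl | hw
      · exact haz
      · exact hw.2.2
    obtain ⟨c, hwc, hcz⟩ := exists_rat_btwn hwz
    have haw : a ≤ w := hwmax a (Set.mem_insert _ _)
    refine ⟨c, haw.trans_lt hwc, hcz.trans hzb, ?_, z, hz, hcz, hzb⟩
    have hsub : s ∩ Set.Ioo a b ⊆ insert z (s ∩ Set.Ioo a c) := by
      rintro x ⟨hx, hxa, hxb⟩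
      rcases (show x ≤ z from hmax x ⟨hx, hxa, hxb⟩).eq_or_lt with rfl | hlt
      · exact Set.mem_insert _ _
      · exact Or.inr ⟨hx, hxa, (show x ≤ w from hwmax x (Or.inr ⟨hx, hxa, hlt⟩)).trans_lt hwc⟩
    have h2 := h.trans ((Set.encard_le_encard hsub).trans (Set.encard_insert_le _ _))
    rw [Nat.cast_add, Nat.cast_one] at h2
    exact (ENat.add_le_add_iff_right ENat.one_ne_top).1 h2
  · rintro ⟨c, hac, hcb, hk, z, hz, hcz, hzb⟩
    have hnot : z ∉ s ∩ Set.Ioo a c := fun h => by linarith [h.2.2]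
    have hsub : insert z (s ∩ Set.Ioo a c) ⊆ s ∩ Set.Ioo a b := by
      rintro x (rfl | ⟨hx, hxa, hxc⟩)
      · exact ⟨hz, hac.trans hcz, hzb⟩
      · exact ⟨hx, hxa, hxc.trans hcb⟩
    refine le_trans ?_ (Set.encard_le_encard hsub)
    rw [Set.encard_insert_of_notMem hnot, Nat.cast_add, Nat.cast_one]
    gcongr

theorem measurable_enat_of_natCast_le {α : Type*} [MeasurableSpace α] {f : α → ℕ∞}
    (h : ∀ k : ℕ, MeasurableSet {x | (k : ℕ∞) ≤ f x}) : Measurable f := by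
  refine measurable_to_countable fun y => ?_
  induction hy : f y using ENat.recTopCoe with
  | top =>
    have : f ⁻¹' {⊤} = ⋂ k : ℕ, {x | (k : ℕ∞) ≤ f x} := by
      ext x
      simp [ENat.eq_top_iff_forall_ge]
    rw [this]
    exact MeasurableSet.iInter h
  | coe n =>
    have : f ⁻¹' {(n : ℕ∞)} = {x | (n : ℕ∞) ≤ f x} \ {x | ((n + 1 : ℕ) : ℕ∞) ≤ f x} := by
      ext x
      simp only [Set.mem_preimage, Set.mem_singleton_iff, Set.mem_sdiff, Set.mem_ofPred_eq, not_le,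
        Nat.cast_add, Nat.cast_one]
      rw [ENat.lt_natCast_add_one_iff, le_antisymm_iff, and_comm]
    rw [this]
    exact (h n).diff (h (n + 1))

theorem Config.measurable_encard_inter {A : Set ℝ} (hA : MeasurableSet A) :
    Measurable fun Z : Config => (Z.1 ∩ A).encard :=
  Measurable.mono (comap_measurable _)
    (le_iSup₂_of_le (f := fun (A : Set ℝ) (_ : MeasurableSet A) =>
      MeasurableSpace.comap (fun Z : Config => (Z.1 ∩ A).encard) inferInstance) A hA le_rfl) le_rfl

theorem Config.measurable_iff {α : Type*} [MeasurableSpace α] {W : α → Config} :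
    Measurable W ↔ ∀ A : Set ℝ, MeasurableSet A → Measurable fun x => ((W x).1 ∩ A).encard := by
  refine ⟨fun h A hA => (Config.measurable_encard_inter hA).comp h, fun h => ?_⟩
  rw [measurable_iff_comap_le, Config.instMeasurableSpace]
  simp only [MeasurableSpace.comap_iSup, MeasurableSpace.comap_comp, iSup_le_iff]
  exact fun A hA => (h A hA).comap_le

theorem Config.measurable_restrict {A : Set ℝ} (hA : MeasurableSet A) :
    Measurable fun Z : Config => Z.restrict A := by
  refine Config.measurable_iff.2 fun B hB => ?_
  simp only [Config.restrict, Set.inter_assoc]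
  exact Config.measurable_encard_inter (hA.inter hB)

/-- On each bounded window the configuration is a finite counting measure, so the π-system of
rational intervals determines its measurability; the windows then exhaust the line. -/
theorem Config.measurable_of_Ioo {α : Type*} [MeasurableSpace α] {W : α → Config}
    (h : ∀ a b : ℚ, a < b → Measurable fun x => ((W x).1 ∩ Set.Ioo (a : ℝ) b).encard) :
    Measurable W := by
  let I : ℕ → Set ℝ := fun n => Set.Ioo ((-n : ℚ) : ℝ) ((n : ℚ) : ℝ)
  let μ : ℕ → α → Measure ℝ := fun n x => Measure.count.restrict ((W x).1 ∩ I n)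
  have hμ : ∀ n x (A : Set ℝ), MeasurableSet A → μ n x A = (((W x).1 ∩ (I n ∩ A)).encard : ENNReal) := by
    intro n x A hA
    have hfin := (W x).2.finite_Ioo ((-n : ℚ) : ℝ) ((n : ℚ) : ℝ)
    simp only [μ]
    rw [Measure.restrict_apply hA, Measure.count_apply (hA.inter hfin.measurableSet),
      Set.inter_comm, Set.inter_assoc]
  have hcast : Measurable fun k : ℕ∞ => (k : ENNReal) := Measurable.of_discrete
  have hint : ∀ n (a b : ℚ), Measurable fun x => μ n x (Set.Ioo (a : ℝ) b) := by
    intro n a b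
    simp only [hμ n _ _ measurableSet_Ioo, I]
    have e : Set.Ioo ((-n : ℚ) : ℝ) ((n : ℚ) : ℝ) ∩ Set.Ioo (a : ℝ) b =
        Set.Ioo ((max (-n) a : ℚ) : ℝ) ((min n b : ℚ) : ℝ) := by
      rw [Set.Ioo_inter_Ioo]; push_cast; rfl
    rw [e]
    rcases lt_or_ge (max (-n) a : ℚ) (min n b) with hlt | hge
    · exact hcast.comp (h _ _ hlt)
    · rw [Set.Ioo_eq_empty (by exact_mod_cast not_lt.2 hge)]
      simp
  have hfinm : ∀ n x, IsFiniteMeasure (μ n x) := by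
    intro n x
    refine ⟨?_⟩
    rw [hμ n x _ MeasurableSet.univ, Set.inter_univ]
    have := ((W x).2.finite_Ioo ((-n : ℚ) : ℝ) ((n : ℚ) : ℝ)).encard_lt_top
    simpa [I] using this
  have hmeas : ∀ n, Measurable (μ n) := by
    intro n
    refine Measurable.measure_of_isPiSystem (S := ⋃ (a : ℚ) (b : ℚ) (_ : a < b), {Set.Ioo (a : ℝ) b})
      ?_ Real.isPiSystem_Ioo_rat ?_ ?_
    · rw [← Real.borel_eq_generateFrom_Ioo_rat]
      exact BorelSpace.measurable_eq
    · intro s hs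
      simp only [Set.mem_iUnion, Set.mem_singleton_iff] at hs
      obtain ⟨a, b, -, rfl⟩ := hs
      exact hint n a b
    · have : ∀ x, μ n x Set.univ = μ n x (Set.Ioo ((-n : ℚ) : ℝ) ((n : ℚ) : ℝ)) := by
        intro x
        rw [hμ n x _ MeasurableSet.univ, hμ n x _ measurableSet_Ioo]
        simp [I]
      simp only [this]
      exact hint n _ _
  refine Config.measurable_iff.2 fun A hA => measurable_enat_of_natCast_le fun k => ?_
  have hk : {x | (k : ℕ∞) ≤ ((W x).1 ∩ A).encard} = ⋃ n, {x | (k : ENNReal) ≤ μ n x A} := by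
    ext x
    simp only [Set.mem_ofPred_eq, Set.mem_iUnion]
    constructor
    · intro hx
      obtain ⟨t, ht, htk⟩ := Set.exists_subset_encard_eq hx
      have htf : t.Finite := Set.finite_of_encard_eq_coe htk
      obtain ⟨M, hM⟩ := (htf.image (fun y => |y|)).bddAbove
      obtain ⟨n, hn⟩ := exists_nat_gt M
      refine ⟨n, ?_⟩
      rw [hμ n x A hA]
      have hsub : t ⊆ (W x).1 ∩ (I n ∩ A) := by
        intro y hy
        have hy' : |y| < n := (hM ⟨y, hy, rfl⟩).trans_lt hn
        rw [abs_lt] at hy'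
        exact ⟨(ht hy).1, by simpa [I] using hy', (ht hy).2⟩
      have := Set.encard_le_encard hsub
      rw [htk] at this
      exact_mod_cast this
    · rintro ⟨n, hn⟩
      rw [hμ n x A hA] at hn
      have hn' : (k : ℕ∞) ≤ ((W x).1 ∩ (I n ∩ A)).encard := by exact_mod_cast hn
      exact hn'.trans (Set.encard_le_encard
        (Set.inter_subset_inter_right _ Set.inter_subset_right))
  rw [hk]
  exact MeasurableSet.iUnion fun n =>
    measurableSet_le measurable_const ((Measure.measurable_coe hA).comp (hmeas n))

theorem Config.measurable_of_nonempty_iff {α : Type*} [MeasurableSpace α] {W : α → Config}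
    {D : ℚ → ℚ → Set α} (hD : ∀ q r, MeasurableSet (D q r))
    (hW : ∀ x, ∀ a b : ℚ, ((W x).1 ∩ Set.Ioo (a : ℝ) b).Nonempty ↔
      ∃ q r : ℚ, a < q ∧ q < r ∧ r < b ∧ x ∈ D q r) : Measurable W := by
  have h1 : ∀ a b : ℚ, MeasurableSet {x | ((W x).1 ∩ Set.Ioo (a : ℝ) b).Nonempty} := by
    intro a b
    have : {x | ((W x).1 ∩ Set.Ioo (a : ℝ) b).Nonempty} =
        ⋃ (q : ℚ) (r : ℚ) (_ : a < q ∧ q < r ∧ r < b), D q r := by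
      ext x
      simp only [Set.mem_ofPred_eq, hW, Set.mem_iUnion, exists_prop, and_assoc]
    rw [this]
    exact MeasurableSet.iUnion fun q => MeasurableSet.iUnion fun r => MeasurableSet.iUnion
      fun _ => hD q r
  have h2 : ∀ k : ℕ, ∀ a b : ℚ,
      MeasurableSet {x | (k : ℕ∞) ≤ ((W x).1 ∩ Set.Ioo (a : ℝ) b).encard} := by
    intro k
    induction k with
    | zero => simp
    | succ k ih =>
      intro a b
      have : {x | ((k + 1 : ℕ) : ℕ∞) ≤ ((W x).1 ∩ Set.Ioo (a : ℝ) b).encard} =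
          ⋃ (c : ℚ) (_ : a < c ∧ c < b), {x | (k : ℕ∞) ≤ ((W x).1 ∩ Set.Ioo (a : ℝ) c).encard} ∩
            {x | ((W x).1 ∩ Set.Ioo (c : ℝ) b).Nonempty} := by
        ext x
        rw [Set.mem_ofPred_eq, succ_le_encard_inter_Ioo_iff (W x).2]
        simp only [Rat.cast_lt, Set.mem_iUnion, Set.mem_inter_iff, Set.mem_ofPred_eq, exists_prop,
          and_assoc]
      rw [this]
      exact MeasurableSet.iUnion fun c => MeasurableSet.iUnion fun _ => (ih a c).inter (h1 c b)
  exact Config.measurable_of_Ioo fun a b _ => measurable_enat_of_natCast_le fun k => h2 k a b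
-- Almost sure simplicity of the zeros
section

variable {Ω : Type*} [mΩ : MeasurableSpace Ω] {P : Measure Ω} {X : ℝ → Ω → ℝ}

/-- At a double zero the path is `o(h)`, so on every fine enough grid of mesh `1/(n+1)` some value
is at most `δ/(n+1)`. A union bound over `n + 2` points makes this `O(δ)`, uniformly in `n`. -/
theorem ae_hasSimpleZeros_of_measure_abs_le
    (hsmall : ∀ t η, 0 < η → P {ω | |X t ω| ≤ η} ≤ ENNReal.ofReal (2 * η))
    (hdiff : ∀ᵐ ω ∂P, Differentiable ℝ fun t => X t ω) :
    ∀ᵐ ω ∂P, HasSimpleZeros fun t => X t ω := by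
  let B : ℤ → Set Ω := fun a =>
    {ω | ∃ z ∈ Set.Icc (a : ℝ) (a + 1), X z ω = 0 ∧ HasDerivAt (fun t => X t ω) 0 z}
  have hB : ∀ a, P (B a) = 0 := by
    intro a
    have hδ : ∀ δ : ℝ, 0 < δ → P (B a) ≤ ENNReal.ofReal (4 * δ) := by
      intro δ hδ
      let A : ℕ → Set Ω := fun n => ⋃ k ∈ Finset.range (n + 2),
        {ω | |X (a + k / (n + 1)) ω| ≤ δ / (n + 1)}
      have hA : ∀ n, P (A n) ≤ ENNReal.ofReal (4 * δ) := by
        intro n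
        have hn : (0 : ℝ) < n + 1 := by positivity
        refine (measure_biUnion_finset_le _ _).trans ?_
        refine (Finset.sum_le_sum fun k _ => hsmall _ _ (div_pos hδ hn)).trans ?_
        rw [Finset.sum_const, Finset.card_range, nsmul_eq_mul, ← ENNReal.ofReal_natCast,
          ← ENNReal.ofReal_mul (by positivity)]
        refine ENNReal.ofReal_le_ofReal ?_
        rw [← mul_div_assoc, ← mul_div_assoc, div_le_iff₀ hn]
        push_cast
        nlinarith [mul_nonneg hδ.le (Nat.cast_nonneg (α := ℝ) n)]
      -- The grid point used is the last one not exceeding `z`, at distance at most the mesh.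
      have hsub : B a ⊆ ⋃ N, ⋂ n, ⋂ (_ : N ≤ n), A n := by
        rintro ω ⟨z, hz, hz0, hd⟩
        have h1 := (hasDerivAt_iff_isLittleO.1 hd).def hδ
        simp only [hz0, smul_zero, sub_zero, Real.norm_eq_abs] at h1
        obtain ⟨ε, hε, h2⟩ := Metric.eventually_nhds_iff.1 h1
        obtain ⟨N, hN⟩ := exists_nat_one_div_lt hε
        simp only [Set.mem_iUnion, Set.mem_iInter]
        refine ⟨N, fun n hn => ?_⟩
        have hn0 : (0 : ℝ) < n + 1 := by positivity
        have hza : 0 ≤ (z - a) * (n + 1) := mul_nonneg (by linarith [hz.1]) hn0.le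
        have hk1 := Nat.floor_le hza
        have hk2 := Nat.lt_floor_add_one ((z - a) * (n + 1))
        have hk3 : ⌊(z - a) * (n + 1)⌋₊ ≤ n + 1 := by
          refine Nat.floor_le_of_le ?_
          push_cast
          exact mul_le_of_le_one_left hn0.le (by linarith [hz.2])
        set k := ⌊(z - a) * (n + 1)⌋₊
        simp only [A, Set.mem_iUnion]
        refine ⟨k, Finset.mem_range.2 (by omega), ?_⟩
        have hdist : |a + k / (n + 1) - z| ≤ 1 / (n + 1) := by
          have e : (a + k / (n + 1) - z : ℝ) = (k - (z - a) * (n + 1)) / (n + 1) := by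
            field_simp
            ring
          rw [e, abs_div, abs_of_pos hn0]
          refine div_le_div_of_nonneg_right ?_ hn0.le
          rw [abs_le]
          constructor <;> linarith
        have hlt : (1 : ℝ) / (n + 1) < ε := by
          refine lt_of_le_of_lt (one_div_le_one_div_of_le (by positivity) ?_) hN
          exact_mod_cast Nat.succ_le_succ hn
        have h3 := h2 (y := a + k / (n + 1)) (by rw [Real.dist_eq]; exact hdist.trans_lt hlt)
        refine h3.trans ?_
        rw [← mul_one_div δ]
        exact mul_le_mul_of_nonneg_left hdist hδ.le
      refine (measure_mono hsub).trans ?_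
      rw [Monotone.measure_iUnion]
      · refine iSup_le fun N => (measure_mono ?_).trans (hA N)
        exact Set.iInter₂_subset N le_rfl
      · intro N M hNM
        exact Set.iInter_mono fun n => Set.iInter_mono' fun h => ⟨hNM.trans h, le_rfl⟩
    have hlim : Tendsto (fun δ : ℝ => ENNReal.ofReal (4 * δ)) (𝓝[>] 0) (𝓝 0) := by
      have : Continuous fun δ : ℝ => ENNReal.ofReal (4 * δ) :=
        ENNReal.continuous_ofReal.comp (by fun_prop)
      have h0 := this.tendsto 0
      simp only [mul_zero, ENNReal.ofReal_zero] at h0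
      exact h0.mono_left nhdsWithin_le_nhds
    have := ge_of_tendsto hlim (eventually_nhdsWithin_of_forall fun δ h => hδ δ h)
    exact le_antisymm this bot_le
  have hall : ∀ᵐ ω ∂P, ∀ a, ω ∉ B a := ae_all_iff.2 fun a => measure_eq_zero_iff_ae_notMem.1 (hB a)
  filter_upwards [hall, hdiff] with ω h1 h2 z hz hd
  exact h1 ⌊z⌋ ⟨z, ⟨Int.floor_le z, (Int.lt_floor_add_one z).le⟩, hz, hd ▸ (h2 z).hasDerivAt⟩

theorem gaussianReal_abs_le (η : ℝ) :
    gaussianReal 0 1 {x | |x| ≤ η} ≤ ENNReal.ofReal (2 * η) := by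
  rw [gaussianReal_apply 0 one_ne_zero]
  have hpdf : ∀ x, gaussianPDF 0 1 x ≤ 1 := by
    intro x
    rw [gaussianPDF, ENNReal.ofReal_le_one, gaussianPDFReal]
    refine mul_le_one₀ ?_ (Real.exp_pos _).le (Real.exp_le_one_iff.2 ?_)
    · refine inv_le_one_of_one_le₀ (Real.one_le_sqrt.2 ?_)
      simp only [NNReal.coe_one, mul_one]
      linarith [Real.pi_gt_three]
    · simp only [NNReal.coe_one, mul_one, sub_zero]
      have := sq_nonneg x
      linarith
  refine (lintegral_mono hpdf).trans ?_
  have : {x : ℝ | |x| ≤ η} = Set.Icc (-η) η := by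
    ext x
    simp [abs_le]
  rw [setLIntegral_one, this, Real.volume_Icc]
  exact ENNReal.ofReal_le_ofReal (by linarith)

/-! ### Recurrence of the process up to sign -/

theorem IsStationaryProcess.integral_mul (hstat : IsStationaryProcess X P)
    (hcent : ∀ t, ∫ ω, X t ω ∂P = 0) (s u : ℝ) :
    ∫ ω, X s ω * X u ω ∂P = reducedCov X P (s - u) := by
  have h := hstat u {s - u, 0}
  have h2 := h.comp (u := fun x : ({s - u, 0} : Finset ℝ) → ℝ =>
    x ⟨s - u, by simp⟩ * x ⟨0, by simp⟩) (by fun_prop)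
  have h3 := h2.integral_eq
  simp only [Function.comp_def, Finset.restrict, sub_add_cancel, zero_add] at h3
  rw [h3]
  simp [reducedCov, covariance, hcent]

theorem ProbabilityTheory.IsGaussianProcess.map_eq_gaussianReal_zero_one
    (hGauss : IsGaussianProcess X P)
    (hcent : ∀ t, ∫ ω, X t ω ∂P = 0) (hstat : IsStationaryProcess X P)
    (hvar : reducedCov X P 0 = 1) (t : ℝ) : P.map (X t) = gaussianReal 0 1 := by
  have h := hstat.integral_mul hcent t t
  rw [sub_self, hvar] at h
  rw [(hGauss.hasGaussianLaw_eval t).map_eq_gaussianReal, hcent,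
    ← covariance_self (hGauss.aemeasurable t)]
  simp [covariance, hcent, h]

theorem integral_sq_shift_sub [IsProbabilityMeasure P] (hGauss : IsGaussianProcess X P)
    (hcent : ∀ t, ∫ ω, X t ω ∂P = 0) (hstat : IsStationaryProcess X P)
    (hvar : reducedCov X P 0 = 1) (s τ ε : ℝ) (hε : ε ^ 2 = 1) :
    Integrable (fun ω => (X (s - τ) ω - ε * X s ω) ^ 2) P ∧
      ∫ ω, (X (s - τ) ω - ε * X s ω) ^ 2 ∂P = 2 - 2 * (ε * reducedCov X P τ) := by
  have hint : ∀ a b, Integrable (fun ω => X a ω * X b ω) P := fun a b =>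
    (hGauss.hasGaussianLaw_eval a).memLp_two.integrable_mul
      (hGauss.hasGaussianLaw_eval b).memLp_two
  have e : (fun ω => (X (s - τ) ω - ε * X s ω) ^ 2) = fun ω =>
      X (s - τ) ω * X (s - τ) ω - 2 * ε * (X s ω * X (s - τ) ω) + X s ω * X s ω := by
    funext ω
    linear_combination (X s ω) ^ 2 * hε
  rw [e]
  have h1 := (hint s (s - τ)).const_mul (2 * ε)
  refine ⟨((hint _ _).sub h1).add (hint _ _), ?_⟩
  have h2 := integral_add ((hint (s - τ) (s - τ)).sub h1) (hint s s)
  simp only [Pi.sub_apply] at h2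
  rw [h2, integral_sub (hint _ _) h1, integral_const_mul]
  simp only [hstat.integral_mul hcent, sub_self, hvar, sub_sub_cancel]
  ring

/-- Both `ε n * a n → x` and `ε n * b n → y`; in the product the factor `ε n ^ 2 = 1` disappears. -/
theorem tendsto_mul_of_tendsto_sq_add_sq {a b ε : ℕ → ℝ} {x y : ℝ} (hε : ∀ n, ε n ^ 2 = 1)
    (h : Tendsto (fun n => (a n - ε n * x) ^ 2 + (b n - ε n * y) ^ 2) atTop (𝓝 0)) :
    Tendsto (fun n => a n * b n) atTop (𝓝 (x * y)) := by
  have habs : ∀ c : ℕ → ℝ, (∀ n, c n ^ 2 ≤ (a n - ε n * x) ^ 2 + (b n - ε n * y) ^ 2) →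
      Tendsto (fun n => ε n * c n) atTop (𝓝 0) := by
    intro c hc
    have h1 : Tendsto (fun n => c n ^ 2) atTop (𝓝 0) :=
      squeeze_zero (fun n => sq_nonneg _) hc h
    have h2 := (Real.continuous_sqrt.tendsto 0).comp h1
    rw [Real.sqrt_zero] at h2
    refine (tendsto_zero_iff_abs_tendsto_zero _).2 (h2.congr fun n => ?_)
    have h3 : |ε n| = 1 := by
      rw [← abs_one, ← sq_eq_sq_iff_abs_eq_abs, hε, one_pow]
    simp [Real.sqrt_sq_eq_abs, abs_mul, h3]
  have ha := habs _ fun n => le_add_of_nonneg_right (sq_nonneg (b n - ε n * y))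
  have hb := habs _ fun n => le_add_of_nonneg_left (sq_nonneg (a n - ε n * x))
  have h4 := ((ha.mul hb).add ((ha.mul_const y).add (hb.mul_const x))).add_const (x * y)
  simp only [zero_mul, add_zero, zero_add] at h4
  refine h4.congr fun n => ?_
  linear_combination ((a n - ε n * x) * (b n - ε n * y) - x * y) * hε n

theorem exists_seq_ae_tendsto_mul_shift [IsProbabilityMeasure P] (hGauss : IsGaussianProcess X P)
    (hcent : ∀ t, ∫ ω, X t ω ∂P = 0) (hstat : IsStationaryProcess X P)
    (hvar : reducedCov X P 0 = 1) {t : ℕ → ℝ}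
    (hCt : Tendsto (fun n => |reducedCov X P (t n)|) atTop (𝓝 1)) (s u : ℝ) :
    ∃ ns : ℕ → ℕ, StrictMono ns ∧ ∀ᵐ ω ∂P,
      Tendsto (fun k => X (s - t (ns k)) ω * X (u - t (ns k)) ω) atTop (𝓝 (X s ω * X u ω)) := by
  let ε : ℕ → ℝ := fun n => if 0 ≤ reducedCov X P (t n) then 1 else -1
  have hε : ∀ n, ε n ^ 2 = 1 := by
    intro n
    simp only [ε]
    split_ifs <;> norm_num
  have hεC : ∀ n, ε n * reducedCov X P (t n) = |reducedCov X P (t n)| := by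
    intro n
    simp only [ε]
    split_ifs with h
    · rw [abs_of_nonneg h, one_mul]
    · rw [abs_of_neg (not_le.1 h)]; ring
  -- Adding the two squared errors lets one subsequence serve both times.
  let f : ℕ → Ω → ℝ := fun n ω =>
    (X (s - t n) ω - ε n * X s ω) ^ 2 + (X (u - t n) ω - ε n * X u ω) ^ 2
  have hf : ∀ n, Integrable (f n) P ∧ ∫ ω, f n ω ∂P = 4 - 4 * |reducedCov X P (t n)| := by
    intro n
    obtain ⟨h1, h2⟩ := integral_sq_shift_sub hGauss hcent hstat hvar s (t n) (ε n) (hε n)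
    obtain ⟨h3, h4⟩ := integral_sq_shift_sub hGauss hcent hstat hvar u (t n) (ε n) (hε n)
    refine ⟨h1.add h3, ?_⟩
    simp only [f]
    rw [integral_add h1 h3, h2, h4, hεC]
    ring
  have hnorm : Tendsto (fun n => eLpNorm (f n - 0) 1 P) atTop (𝓝 0) := by
    have h1 : Tendsto (fun n => 4 - 4 * |reducedCov X P (t n)|) atTop (𝓝 0) := by
      have := (hCt.const_mul 4).const_sub 4
      simpa using this
    have h2 := ENNReal.tendsto_ofReal h1
    rw [ENNReal.ofReal_zero] at h2
    refine h2.congr fun n => ?_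
    rw [sub_zero, eLpNorm_one_eq_lintegral_enorm,
      ← ofReal_integral_norm_eq_lintegral_enorm (hf n).1, ← (hf n).2]
    congr 2
    funext ω
    rw [Real.norm_of_nonneg]
    positivity
  obtain ⟨ns, hns, hlim⟩ := (tendstoInMeasure_of_tendsto_eLpNorm one_ne_zero
    (fun n => (hf n).1.aestronglyMeasurable) aestronglyMeasurable_zero hnorm).exists_seq_tendsto_ae
  refine ⟨ns, hns, hlim.mono fun ω hω => ?_⟩
  exact tendsto_mul_of_tendsto_sq_add_sq (fun k => hε (ns k)) hω

/-! ### Recovering the zero process from signs -/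

theorem zeroProcess_val {Ω : Type*} {X : ℝ → Ω → ℝ} {ω : Ω} (h : IsLocallyFiniteSet (zeroSet X ω)) :
    (zeroProcess X ω).1 = {t | X t ω = 0} := by
  have e : zeroProcess X ω = (⟨zeroSet X ω, h⟩ : Config) := dif_pos h
  rw [e]
  rfl

theorem Config.restrict_val (Z : Config) (A : Set ℝ) : (Z.restrict A).1 = Z.1 ∩ A := rfl

theorem Config.restrict_restrict (Z : Config) {A B : Set ℝ} (hAB : A ⊆ B) :
    (Z.restrict B).restrict A = Z.restrict A := by
  refine Subtype.ext ?_
  change Z.1 ∩ B ∩ A = Z.1 ∩ A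
  rw [Set.inter_assoc, Set.inter_eq_self_of_subset_right hAB]

open Classical in
theorem measurable_ite_zeroProcess {Ω : Type*} {X : ℝ → Ω → ℝ} (m : MeasurableSpace Ω)
    {G : Set Ω} {D : ℚ → ℚ → Set Ω}
    (hG : MeasurableSet[m] G) (hD : ∀ q r, MeasurableSet[m] (D q r))
    (hcont : ∀ ω ∈ G, Continuous fun t => X t ω) (hsimple : ∀ ω ∈ G, HasSimpleZeros fun t => X t ω)
    (hsign : ∀ ω ∈ G, ∀ q r : ℚ, ω ∈ D q r ↔ X q ω * X r ω < 0) :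
    Measurable[m] fun ω => if ω ∈ G then zeroProcess X ω else Config.empty := by
  refine @Config.measurable_of_nonempty_iff Ω m _ (fun q r => G ∩ D q r)
    (fun q r => hG.inter (hD q r)) fun ω a b => ?_
  by_cases hω : ω ∈ G
  · simp only [if_pos hω]
    rw [zeroProcess_val ((hsimple ω hω).isLocallyFiniteSet (hcont ω hω)),
      (hsimple ω hω).nonempty_inter_Ioo_iff (hcont ω hω)]
    simp only [Rat.cast_lt, Set.mem_inter_iff, hω, true_and, hsign ω hω]
  · simp [hω, Config.empty]

/-- The good event is conull, hence measurable in the completion of any `m`. -/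
theorem eventuallyMeasurable_zeroProcess (m : MeasurableSpace Ω)
    (hcont : ∀ᵐ ω ∂P, Continuous fun t => X t ω)
    (hsimple : ∀ᵐ ω ∂P, HasSimpleZeros fun t => X t ω)
    (hsign : ∀ q r : ℚ, EventuallyMeasurableSet m (ae P) {ω | X q ω * X r ω < 0}) :
    EventuallyMeasurable m (ae P) (zeroProcess X) := by
  classical
  let G : Set Ω := {ω | (Continuous fun t => X t ω) ∧ HasSimpleZeros fun t => X t ω}
  have hG : G ∈ ae P := hcont.and hsimple
  have h := measurable_ite_zeroProcess (X := X) (eventuallyMeasurableSpace m (ae P))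
    (eventuallyMeasurableSet_of_mem_filter hG) hsign (fun ω h => h.1) (fun ω h => h.2)
    fun ω _ q r => Iff.rfl
  refine EventuallyMeasurable.congr h ?_
  filter_upwards [hG] with ω hω
  rw [if_pos hω]

theorem aemeasurable_zeroProcess (hX : ∀ t, AEMeasurable (X t) P)
    (hcont : ∀ᵐ ω ∂P, Continuous fun t => X t ω)
    (hsimple : ∀ᵐ ω ∂P, HasSimpleZeros fun t => X t ω) :
    AEMeasurable (zeroProcess X) P := by
  classical
  have hmk : ∀ᵐ ω ∂P, ∀ q : ℚ, X q ω = (hX q).mk _ ω := ae_all_iff.2 fun q => (hX q).ae_eq_mk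
  -- The good event need not be measurable; the complement of a measurable null superset of the bad
  -- one replaces it.
  obtain ⟨N, hNsub, hNm, hN⟩ :=
    exists_measurable_superset_of_null (ae_iff.1 (hcont.and (hsimple.and hmk)))
  have hGsub : ∀ ω ∈ Nᶜ, (Continuous fun t => X t ω) ∧ (HasSimpleZeros fun t => X t ω) ∧
      ∀ q : ℚ, X q ω = (hX q).mk _ ω := fun ω hω => by
    by_contra h
    exact hω (hNsub h)
  refine ⟨_, measurable_ite_zeroProcess (X := X) mΩ (G := Nᶜ)
    (D := fun q r => {ω | (hX q).mk _ ω * (hX r).mk _ ω < 0}) hNm.compl (fun q r => ?_)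
    (fun ω h => (hGsub ω h).1) (fun ω h => (hGsub ω h).2.1) (fun ω h q r => ?_), ?_⟩
  · exact measurableSet_lt ((hX q).measurable_mk.mul (hX r).measurable_mk) measurable_const
  · rw [Set.mem_ofPred_eq, ← (hGsub ω h).2.2 q, ← (hGsub ω h).2.2 r]
  · filter_upwards [measure_eq_zero_iff_ae_notMem.1 hN] with ω hω
    rw [if_pos (show ω ∈ Nᶜ from hω)]

/-! ### Prediction from the remote past -/

theorem eventuallyMeasurableSet_mul_neg_of_le (hcont : ∀ᵐ ω ∂P, Continuous fun t => X t ω)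
    (hsimple : ∀ᵐ ω ∂P, HasSimpleZeros fun t => X t ω)
    (hne : ∀ s, ∀ᵐ ω ∂P, X s ω ≠ 0) {s u T : ℝ} (hsu : s < u) (huT : u ≤ T) :
    EventuallyMeasurableSet (sigmaRestrict (zeroProcess X) (Set.Iio T)) (ae P)
      {ω | X s ω * X u ω < 0} := by
  let E : Set Config := {Z | ∃ n : ℕ, Odd n ∧ (Z.1 ∩ Set.Ioo s u).encard = n}
  have hE : MeasurableSet E :=
    Config.measurable_encard_inter measurableSet_Ioo
      (MeasurableSet.of_discrete (s := {k : ℕ∞ | ∃ n : ℕ, Odd n ∧ k = n}))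
  refine ⟨_, ⟨E, hE, rfl⟩, ?_⟩
  refine Filter.eventuallyEq_set.2 ?_
  filter_upwards [hcont, hsimple, hne s, hne u] with ω h1 h2 h3 h4
  have hrestrict : ((zeroProcess X ω).restrict (Set.Iio T)).1 ∩ Set.Ioo s u =
      {t | X t ω = 0} ∩ Set.Ioo s u := by
    rw [Config.restrict_val, zeroProcess_val (h2.isLocallyFiniteSet h1), Set.inter_assoc,
      Set.inter_eq_self_of_subset_right fun x hx => Set.mem_Iio.2 (hx.2.trans_le huT)]
  simp only [Set.mem_ofPred_eq, Set.mem_preimage, E, hrestrict]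
  exact h2.mul_neg_iff_odd h1 hsu h3 h4

/-- As the limit is almost surely nonzero, it is negative exactly when the products are eventually
negative. -/
theorem eventuallyMeasurableSet_mul_neg (m : MeasurableSpace Ω) {s u : ℝ} {τ : ℕ → ℝ}
    (hne : ∀ s, ∀ᵐ ω ∂P, X s ω ≠ 0)
    (hm : ∀ k, EventuallyMeasurableSet m (ae P) {ω | X (s - τ k) ω * X (u - τ k) ω < 0})
    (hlim : ∀ᵐ ω ∂P, Tendsto (fun k => X (s - τ k) ω * X (u - τ k) ω) atTop
      (𝓝 (X s ω * X u ω))) :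
    EventuallyMeasurableSet m (ae P) {ω | X s ω * X u ω < 0} := by
  have hL : EventuallyMeasurableSet m (ae P)
      (⋃ N, ⋂ k, ⋂ (_ : N ≤ k), {ω | X (s - τ k) ω * X (u - τ k) ω < 0}) :=
    MeasurableSet.iUnion fun N => MeasurableSet.iInter fun k => MeasurableSet.iInter fun _ => hm k
  refine hL.congr (Filter.eventuallyEq_set.2 ?_)
  filter_upwards [hlim, hne s, hne u] with ω h1 h2 h3
  simp only [Set.mem_iUnion, Set.mem_iInter, Set.mem_ofPred_eq]
  rw [← eventually_atTop]
  constructor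
  · exact fun h => h1.eventually (gt_mem_nhds h)
  · intro h
    refine lt_of_le_of_ne (le_of_tendsto h1 (h.mono fun _ => le_of_lt)) (mul_ne_zero h2 h3)

/-- The representatives `A n` may differ, but their liminf is unchanged by dropping finitely many of
them, so it lies in every `m k`; it agrees with `s` off one exceptional set. -/
theorem EventuallyMeasurableSet.of_antitone {Ω : Type*} {m : ℕ → MeasurableSpace Ω} (hm : Antitone m)
    {l : Filter Ω} [CountableInterFilter l] {s : Set Ω}
    (h : ∀ n, EventuallyMeasurableSet (m n) l s) :
    EventuallyMeasurableSet (⨅ n, m n) l s := by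
  choose A hA hsA using h
  refine ⟨⋃ N, ⋂ n, ⋂ (_ : N ≤ n), A n, ?_, ?_⟩
  · rw [MeasurableSpace.measurableSet_iInf]
    intro k
    have e : (⋃ N, ⋂ n, ⋂ (_ : N ≤ n), A n) = ⋃ N, ⋂ n, ⋂ (_ : N + k ≤ n), A n := by
      ext x
      simp only [Set.mem_iUnion, Set.mem_iInter]
      exact ⟨fun ⟨N, hN⟩ => ⟨N, fun n hn => hN n (by omega)⟩,
        fun ⟨N, hN⟩ => ⟨N + k, fun n hn => hN n hn⟩⟩
    rw [e]
    exact MeasurableSet.iUnion fun N => MeasurableSet.iInter fun n => MeasurableSet.iInter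
      fun hn => hm (show k ≤ n by omega) _ (hA n)
  · have hall : ∀ᶠ x in l, ∀ n, x ∈ s ↔ x ∈ A n :=
      eventually_countable_forall.2 fun n => Filter.eventuallyEq_set.1 (hsA n)
    refine Filter.eventuallyEq_set.2 (hall.mono fun x hx => ?_)
    simp only [Set.mem_iUnion, Set.mem_iInter, ← hx]
    exact ⟨fun h => ⟨0, fun _ _ => h⟩, fun ⟨N, hN⟩ => hN N le_rfl⟩

theorem sigmaRestrict_mono {Ω : Type*} (Z : Ω → Config) {A B : Set ℝ} (hA : MeasurableSet A) (hAB : A ⊆ B) :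
    sigmaRestrict Z A ≤ sigmaRestrict Z B := by
  have e : (fun ω => (Z ω).restrict A) = (fun z : Config => z.restrict A) ∘
      fun ω => (Z ω).restrict B := by
    funext ω
    exact ((Z ω).restrict_restrict hAB).symm
  rw [sigmaRestrict, e, ← MeasurableSpace.comap_comp]
  exact MeasurableSpace.comap_mono (Config.measurable_restrict hA).comap_le

theorem sigmaRestrict_le {Ω : Type*} (Z : Ω → Config) {A : Set ℝ} (hA : MeasurableSet A) :
    sigmaRestrict Z A ≤ MeasurableSpace.comap Z inferInstance :=
  ((Config.measurable_restrict hA).comp (comap_measurable Z)).comap_le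

theorem eventuallyMeasurableSpace_mono {Ω : Type*} {m m' : MeasurableSpace Ω} (h : m ≤ m')
    (l : Filter Ω) [CountableInterFilter l] : eventuallyMeasurableSpace m l ≤ eventuallyMeasurableSpace m' l :=
  fun _ ⟨t, ht, hst⟩ => ⟨t, h t ht, hst⟩

theorem completelyPredictable_of_forall_eventuallyMeasurable {Z : Ω → Config}
    (h : ∀ T : ℝ, EventuallyMeasurable (sigmaRestrict Z (Set.Iio T)) (ae P) Z) :
    CompletelyPredictable Z P := by
  refine le_antisymm ?_ (eventuallyMeasurableSpace_mono
    ((iInf_le _ (0 : ℝ)).trans (sigmaRestrict_le Z measurableSet_Iio)) _)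
  rintro s ⟨s', ⟨S, hS, rfl⟩, hs⟩
  refine EventuallyMeasurableSet.congr ?_ hs
  have hanti : Antitone fun n : ℕ => sigmaRestrict Z (Set.Iio (-n : ℝ)) := by
    intro n k hnk
    refine sigmaRestrict_mono Z measurableSet_Iio (Set.Iio_subset_Iio ?_)
    exact neg_le_neg (by exact_mod_cast hnk)
  have h1 := EventuallyMeasurableSet.of_antitone hanti (l := ae P) (s := Z ⁻¹' S)
    fun n => h (-n) hS
  refine eventuallyMeasurableSpace_mono (le_iInf fun T => ?_) _ _ h1
  obtain ⟨n, hn⟩ := exists_nat_gt (-T)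
  exact (iInf_le _ n).trans (sigmaRestrict_mono Z measurableSet_Iio
    (Set.Iio_subset_Iio (by linarith)))

theorem maximallyRigid_of_forall_eventuallyMeasurable {Z : Ω → Config}
    (h : ∀ T : ℝ, EventuallyMeasurable (sigmaRestrict Z (Set.Iio T)) (ae P) Z) :
    MaximallyRigid Z P := by
  intro φ hφ _ T hT
  have h1 : EventuallyMeasurable (sigmaRestrict Z (Set.Icc (-T) T)ᶜ) (ae P) Z :=
    (h (-T)).mono (eventuallyMeasurableSpace_mono (sigmaRestrict_mono Z measurableSet_Iio
      fun x (hx : x < -T) (hx' : x ∈ Set.Icc (-T) T) => (not_lt.2 hx'.1) hx) _) le_rfl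
  exact (hφ.comp (Config.measurable_restrict measurableSet_Icc)).comp_eventuallyMeasurable h1

end

/-! ### The main theorem -/

theorem mainTheorem4 {Ω : Type*} [MeasurableSpace Ω] (P : Measure Ω) [IsProbabilityMeasure P]
    (X : ℝ → Ω → ℝ)
    (hGauss : IsGaussianProcess X P)
    (hcent : ∀ t, ∫ ω, X t ω ∂P = 0)
    (hstat : IsStationaryProcess X P)
    (hvar : reducedCov X P 0 = 1)
    (hC1 : ∀ᵐ ω ∂P, ContDiff ℝ 1 (fun t => X t ω))
    (t : ℕ → ℝ) (ht : Tendsto t atTop atTop)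
    (hCt : Tendsto (fun n => |reducedCov X P (t n)|) atTop (𝓝 1)) :
    (∀ᵐ ω ∂P, IsLocallyFiniteSet (zeroSet X ω)) ∧
      AEMeasurable (zeroProcess X) P ∧
      CompletelyPredictable (zeroProcess X) P ∧
      MaximallyRigid (zeroProcess X) P := by
  have hX := hGauss.aemeasurable
  have hmap := hGauss.map_eq_gaussianReal_zero_one hcent hstat hvar
  have hcont : ∀ᵐ ω ∂P, Continuous fun t => X t ω := hC1.mono fun ω h => h.continuous
  have hsmall : ∀ t η, 0 < η → P {ω | |X t ω| ≤ η} ≤ ENNReal.ofReal (2 * η) := by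
    intro t η _
    have := gaussianReal_abs_le η
    rwa [← hmap t, Measure.map_apply_of_aemeasurable (hX t)
      (measurableSet_le (by fun_prop) measurable_const)] at this
  have hne : ∀ t, ∀ᵐ ω ∂P, X t ω ≠ 0 := by
    intro t
    have : ∀ᵐ x ∂(P.map (X t)), x ≠ 0 := by
      rw [hmap t]
      have := nullSingletonClass_gaussianReal (μ := 0) (v := 1) one_ne_zero
      exact compl_mem_ae_iff.2 (measure_singleton 0)
    exact ae_of_ae_map (hX t) this
  have hsimple := ae_hasSimpleZeros_of_measure_abs_le hsmall
    (hC1.mono fun ω h => h.differentiable one_ne_zero)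
  have hsign : ∀ T s u : ℝ, s < u → EventuallyMeasurableSet
      (sigmaRestrict (zeroProcess X) (Set.Iio T)) (ae P) {ω | X s ω * X u ω < 0} := by
    intro T s u hsu
    obtain ⟨ns, hns, hlim⟩ := exists_seq_ae_tendsto_mul_shift hGauss hcent hstat hvar hCt s u
    -- From index `N` on, the shifted interval ends at or before `T`.
    obtain ⟨N, hN⟩ := eventually_atTop.1
      ((ht.comp hns.tendsto_atTop).eventually_ge_atTop (u - T))
    refine eventuallyMeasurableSet_mul_neg _ (τ := fun k => t (ns (k + N))) hne (fun k => ?_)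
      (hlim.mono fun ω h => h.comp (tendsto_add_atTop_nat N))
    refine eventuallyMeasurableSet_mul_neg_of_le hcont hsimple hne (by linarith) ?_
    have := hN (k + N) (by omega)
    simp only [Function.comp_apply] at this
    linarith
  have hpred : ∀ T : ℝ, EventuallyMeasurable (sigmaRestrict (zeroProcess X) (Set.Iio T)) (ae P)
      (zeroProcess X) := by
    intro T
    refine eventuallyMeasurable_zeroProcess _ hcont hsimple fun q r => ?_
    rcases lt_trichotomy (q : ℝ) r with h | h | h
    · exact hsign T q r h
    · have : {ω | X q ω * X r ω < 0} = ∅ := by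
        ext ω
        simp [h, mul_self_nonneg]
      rw [this]
      exact (@MeasurableSet.empty _ (sigmaRestrict (zeroProcess X) (Set.Iio T))).eventuallyMeasurableSet
    · simp only [mul_comm (X q _)]
      exact hsign T r q h
  refine ⟨?_, aemeasurable_zeroProcess hX hcont hsimple,
    completelyPredictable_of_forall_eventuallyMeasurable hpred,
    maximallyRigid_of_forall_eventuallyMeasurable hpred⟩
  filter_upwards [hcont, hsimple] with ω h1 h2 using h2.isLocallyFiniteSet h1
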